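/- Call a map $f:X\to Y$ of metric spaces $L$-bi-Lipschitz ($1\le L<\infty$) if $L^{-1}d(x,y)\le d(f(x),f(y))\le L\,d(x,y)$ for all $x,y\in X$. A metric space $X$ is uniformly bi-Lipschitz homogeneous if, for some $L$, there is a collection of $L$-bi-Lipschitz self-homeomorphisms of $X$ such that for all $x,y\in X$ some $f$ in the collection has $f(x)=y$; it is so with respect to a group if the collection can be taken to be a group under composition. $X=(X,d)$ is quasi-self-similar if there are $x\in X$ and $1\le L<\infty$ such that for every $s\ge 1$ there is an $L$-bi-Lipschitz homeomorphism $(X,s\,d)\to(X,d)$ fixing $x$. $X$ is Ahlfors $Q$-regular if there is $1\le C<\infty$ with $C^{-1}r^Q\le\mathcal H^Q(B(x;r))\le C r^Q$ for all $x\in X$ and $r>0$. For $p\in X$, the metric inversion $X_p^*$ is the set $(X\cup\{\infty\})\setminus\{p\}$ with the distance $d_p(x,y)=\inf\sum_{i=0}^{k-1} i_p(x_i,x_{i+1})$, the infimum being over all finite chains $x=x_0,\dots,x_k=y$, where $i_p(x,y)=\frac{d(x,y)}{d(x,p)d(y,p)}$, $i_p(x,\infty)=i_p(\infty,x)=\frac1{d(x,p)}$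 and $i_p(\infty,\infty)=0$. $X$ is inversion invariant bi-Lipschitz homogeneous if both $X$ and $X_p^*$, for some $p\in X$, are uniformly bi-Lipschitz homogeneous. Theorem. For every real $Q$ with $1<Q<2$ there is a set $\Gamma\subset\mathbb R^2$, homeomorphic to $\mathbb R$, which with the Euclidean distance is proper, Ahlfors $Q$-regular and uniformly bi-Lipschitz homogeneous with respect to a group, such that $S=\Gamma\times\mathbb R\subset\mathbb R^3$, with the Euclidean distance, is homeomorphic to $\mathbb R^2$, quasi-self-similar and uniformly bi-Lipschitz homogeneous with respect to a group, but is not inversion invariant bi-Lipschitz homogeneous. -/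

import Mathlib

/-- `f` is an `L`-bi-Lipschitz map (the constant satisfies `1 ≤ L < ∞`). -/
def IsBiLipschitz {X Y : Type*} [MetricSpace X] [MetricSpace Y] (L : ℝ) (f : X → Y) : Prop :=
  1 ≤ L ∧ ∀ x y : X, L⁻¹ * dist x y ≤ dist (f x) (f y) ∧ dist (f x) (f y) ≤ L * dist x y

/-- `X` is uniformly bi-Lipschitz homogeneous: for some `L`, the points of `X` are permuted
transitively by a collection of `L`-bi-Lipschitz self-homeomorphisms. -/
def IsUniformlyBiLipschitzHomogeneous (X : Type*) [MetricSpace X] : Prop :=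
  ∃ (L : ℝ) (F : Set (X ≃ₜ X)),
    (∀ f ∈ F, IsBiLipschitz L f) ∧ ∀ x y : X, ∃ f ∈ F, f x = y

/-- `X` is uniformly bi-Lipschitz homogeneous with respect to a group: the collection of
`L`-bi-Lipschitz self-homeomorphisms can be taken to be a group under composition. -/
def IsUniformlyBiLipschitzHomogeneousGroup (X : Type*) [MetricSpace X] : Prop :=
  ∃ (L : ℝ) (G : Subgroup (X ≃ₜ X)),
    (∀ g ∈ G, IsBiLipschitz L g) ∧ ∀ x y : X, ∃ g ∈ G, g x = y

/-- `X = (X, d)` is quasi-self-similar: for some base point `x`, some constant `L`, and every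
`s ≥ 1`, there is an `L`-bi-Lipschitz homeomorphism `(X, s d, x) → (X, d, x)`. -/
def IsQuasiSelfSimilar (X : Type*) [MetricSpace X] : Prop :=
  ∃ (x : X) (L : ℝ), 1 ≤ L ∧ ∀ s : ℝ, 1 ≤ s → ∃ f : X ≃ₜ X, f x = x ∧
    ∀ a b : X, L⁻¹ * (s * dist a b) ≤ dist (f a) (f b) ∧ dist (f a) (f b) ≤ L * (s * dist a b)

/-- `X` is Ahlfors `Q`-regular: balls of radius `r` have `Q`-dimensional Hausdorff measure
comparable to `r ^ Q`, with a constant independent of the centre and of `r`. -/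
def IsAhlforsRegular (Q : ℝ) (X : Type*) [MetricSpace X] [MeasurableSpace X] [BorelSpace X] :
    Prop :=
  ∃ C : ℝ, 1 ≤ C ∧ ∀ (x : X) (r : ℝ), 0 < r →
    ENNReal.ofReal (C⁻¹ * r ^ Q) ≤ MeasureTheory.Measure.hausdorffMeasure Q (Metric.ball x r) ∧
      MeasureTheory.Measure.hausdorffMeasure Q (Metric.ball x r) ≤ ENNReal.ofReal (C * r ^ Q)

/-- The underlying set `(X ∪ {∞}) \ {p}` of the metric inversion of `X` at `p`;
`none` is the point `∞`. -/
def MetricInversion {X : Type*} [MetricSpace X] (p : X) : Type _ := Option {x : X // x ≠ p}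

namespace MetricInversion

variable {X : Type*} [MetricSpace X] {p : X}

/-- `i_p(x, y) = d(x, y) / (d(x, p) d(y, p))`, `i_p(x, ∞) = 1 / d(x, p)`, `i_p(∞, ∞) = 0`. -/
noncomputable def preDist : MetricInversion p → MetricInversion p → ℝ
  | some x, some y => dist x.1 y.1 / (dist x.1 p * dist y.1 p)
  | some x, none => 1 / dist x.1 p
  | none, some y => 1 / dist y.1 p
  | none, none => 0

/-- The lengths, measured by `i_p`, of the finite chains from `x` to `y`. -/
def chainSums (x y : MetricInversion p) : Set ℝ :=
  {r | ∃ (k : ℕ) (z : ℕ → MetricInversion p), z 0 = x ∧ z k = y ∧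
    r = ∑ i ∈ Finset.range k, preDist (z i) (z (i + 1))}

/-- The inversion distance `d_p`: the infimum of the `i_p`-lengths of chains. -/
noncomputable def invDist (x y : MetricInversion p) : ℝ := sInf (chainSums x y)

/-- The reciprocal distance to `p`, extended by `0` at `∞`. -/
noncomputable def recip : MetricInversion p → ℝ
  | some x => 1 / dist x.1 p
  | none => 0

theorem preDist_nonneg (x y : MetricInversion p) : 0 ≤ preDist x y := by
  rcases x with _ | x <;> rcases y with _ | y <;> simp only [preDist] <;> positivity

theorem preDist_self (x : MetricInversion p) : preDist x x = 0 := by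
  rcases x with _ | x <;> simp [preDist]

theorem preDist_comm (x y : MetricInversion p) : preDist x y = preDist y x := by
  rcases x with _ | x <;> rcases y with _ | y <;> simp only [preDist]
  rw [dist_comm, mul_comm]

theorem recip_nonneg (x : MetricInversion p) : 0 ≤ recip x := by
  rcases x with _ | x <;> simp only [recip] <;> positivity

theorem recip_sub_le (x y : MetricInversion p) : recip x - recip y ≤ preDist x y := by
  rcases x with _ | x <;> rcases y with _ | y <;> simp only [recip, preDist]
  · simp
  · have : 0 ≤ 1 / dist y.1 p := by positivity
    linarith
  · simp
  · have hx : 0 < dist x.1 p := dist_pos.2 x.2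
    have hy : 0 < dist y.1 p := dist_pos.2 y.2
    rw [div_sub_div _ _ hx.ne' hy.ne']
    gcongr
    have := dist_triangle y.1 x.1 p
    rw [dist_comm y.1 x.1] at this
    linarith

theorem preDist_le (x y : MetricInversion p) : preDist x y ≤ recip x + recip y := by
  rcases x with _ | x <;> rcases y with _ | y <;> simp only [recip, preDist]
  · simp
  · simp
  · simp
  · have hx : 0 < dist x.1 p := dist_pos.2 x.2
    have hy : 0 < dist y.1 p := dist_pos.2 y.2
    rw [div_add_div _ _ hx.ne' hy.ne']
    gcongr
    have := dist_triangle_right x.1 y.1 p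
    linarith

theorem recip_sub_le_sum (z : ℕ → MetricInversion p) (j : ℕ) :
    recip (z 0) - recip (z j) ≤ ∑ i ∈ Finset.range j, preDist (z i) (z (i + 1)) := by
  induction j with
  | zero => simp
  | succ j ih =>
    rw [Finset.sum_range_succ]
    have := recip_sub_le (z j) (z (j + 1))
    linarith

theorem quarter_le_sum_of_le (z : ℕ → MetricInversion p) (k : ℕ)
    (h : recip (z k) ≤ recip (z 0)) :
    preDist (z 0) (z k) / 4 ≤ ∑ i ∈ Finset.range k, preDist (z i) (z (i + 1)) := by
  have hle := preDist_le (z 0) (z k)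
  by_cases hc : ∃ j ≤ k, recip (z j) < recip (z 0) / 2
  · obtain ⟨j, hj, hlt⟩ := hc
    have h1 := recip_sub_le_sum z j
    have h2 : ∑ i ∈ Finset.range j, preDist (z i) (z (i + 1)) ≤
        ∑ i ∈ Finset.range k, preDist (z i) (z (i + 1)) :=
      Finset.sum_le_sum_of_subset_of_nonneg (Finset.range_mono hj)
        fun _ _ _ => preDist_nonneg _ _
    linarith
  · push Not at hc
    rcases (recip_nonneg (z 0)).eq_or_lt with h0 | h0
    · have h1 : preDist (z 0) (z k) ≤ 0 := by linarith
      have h2 : 0 ≤ ∑ i ∈ Finset.range k, preDist (z i) (z (i + 1)) :=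
        Finset.sum_nonneg fun _ _ => preDist_nonneg _ _
      linarith
    · have hw : ∀ j ≤ k, ∃ w : {x : X // x ≠ p}, z j = some w := by
        intro j hj
        have hj' := hc j hj
        rcases hz : z j with _ | w
        · rw [hz] at hj'
          have : recip (none : MetricInversion p) = 0 := rfl
          have hj'' : recip (z 0) / 2 ≤ 0 := hj'
          linarith
        · exact ⟨w, rfl⟩
      have hnone : ∀ j, ∃ w : {x : X // x ≠ p}, j ≤ k → z j = some w := by
        intro j
        by_cases hj : j ≤ k
        · obtain ⟨w, hw⟩ := hw j hj
          exact ⟨w, fun _ => hw⟩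
        · obtain ⟨w, _⟩ := hw 0 (Nat.zero_le k)
          exact ⟨w, fun h => absurd h hj⟩
      choose w hw using hnone
      set a := recip (z 0) with ha
      have hr : ∀ j ≤ k, recip (z j) = 1 / dist (w j).1 p := fun j hj => by
        rw [hw j hj]; rfl
      have hform : ∀ i j, i ≤ k → j ≤ k →
          preDist (z i) (z j) = dist (w i).1 (w j).1 * (recip (z i) * recip (z j)) := by
        intro i j hi hj
        rw [hr i hi, hr j hj, hw i hi, hw j hj]
        simp only [preDist]
        rw [one_div_mul_one_div, mul_one_div]
      have hd : dist (w 0).1 (w k).1 ≤ ∑ i ∈ Finset.range k, dist (w i).1 (w (i + 1)).1 :=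
        dist_le_range_sum_dist (fun i => (w i).1) k
      calc preDist (z 0) (z k) / 4
          = dist (w 0).1 (w k).1 * (a * recip (z k)) / 4 := by
            rw [hform 0 k (Nat.zero_le k) le_rfl]
        _ ≤ dist (w 0).1 (w k).1 * (a * a) / 4 := by gcongr
        _ ≤ (∑ i ∈ Finset.range k, dist (w i).1 (w (i + 1)).1) * (a * a) / 4 := by gcongr
        _ = ∑ i ∈ Finset.range k, dist (w i).1 (w (i + 1)).1 * ((a / 2) * (a / 2)) := by
            rw [← Finset.sum_mul]; ring
        _ ≤ ∑ i ∈ Finset.range k, preDist (z i) (z (i + 1)) := by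
            refine Finset.sum_le_sum fun i hi => ?_
            have hi' : i < k := Finset.mem_range.1 hi
            rw [hform i (i + 1) hi'.le hi']
            have h1 := hc i hi'.le
            have h2 := hc (i + 1) hi'
            have h3 := recip_nonneg (z i)
            gcongr

theorem mem_chainSums_comm {x y : MetricInversion p} {r : ℝ} (h : r ∈ chainSums x y) :
    r ∈ chainSums y x := by
  obtain ⟨k, z, h0, hk, rfl⟩ := h
  refine ⟨k, fun i => z (k - i), by simpa using hk, by simpa using h0, ?_⟩
  rw [← Finset.sum_range_reflect]
  refine Finset.sum_congr rfl fun i hi => ?_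
  have hi' : i < k := Finset.mem_range.1 hi
  have e1 : k - 1 - i + 1 = k - i := by omega
  have e2 : k - 1 - i = k - (i + 1) := by omega
  rw [e1, e2, preDist_comm]

theorem quarter_le {x y : MetricInversion p} {r : ℝ} (h : r ∈ chainSums x y) :
    preDist x y / 4 ≤ r := by
  rcases le_total (recip y) (recip x) with hxy | hxy
  · obtain ⟨k, z, rfl, rfl, rfl⟩ := h
    exact quarter_le_sum_of_le z k hxy
  · obtain ⟨k, z, rfl, rfl, rfl⟩ := mem_chainSums_comm h
    rw [preDist_comm]
    exact quarter_le_sum_of_le z k hxy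

theorem preDist_mem_chainSums (x y : MetricInversion p) : preDist x y ∈ chainSums x y :=
  ⟨1, fun i => if i = 0 then x else y, by simp, by simp, by simp⟩

theorem bddBelow_chainSums (x y : MetricInversion p) : BddBelow (chainSums x y) :=
  ⟨preDist x y / 4, fun _ h => quarter_le h⟩

theorem invDist_le (x y : MetricInversion p) : invDist x y ≤ preDist x y :=
  csInf_le (bddBelow_chainSums x y) (preDist_mem_chainSums x y)

theorem quarter_le_invDist (x y : MetricInversion p) : preDist x y / 4 ≤ invDist x y :=
  le_csInf ⟨_, preDist_mem_chainSums x y⟩ fun _ h => quarter_le h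

theorem add_mem_chainSums {x y w : MetricInversion p} {r s : ℝ} (hr : r ∈ chainSums x y)
    (hs : s ∈ chainSums y w) : r + s ∈ chainSums x w := by
  obtain ⟨k, z, rfl, hk, rfl⟩ := hr
  obtain ⟨l, u, hu, rfl, rfl⟩ := hs
  refine ⟨k + l, fun i => if i ≤ k then z i else u (i - k), by simp, ?_, ?_⟩
  · rcases Nat.eq_zero_or_pos l with rfl | hl
    · simp [hk, hu]
    · have : ¬ k + l ≤ k := by omega
      simp only [this, if_false]
      congr 1
      omega
  · rw [Finset.sum_range_add]
    congr 1
    · refine Finset.sum_congr rfl fun i hi => ?_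
      have hi' : i < k := Finset.mem_range.1 hi
      have h1 : i ≤ k := hi'.le
      have h2 : i + 1 ≤ k := hi'
      simp only [h1, h2, if_true]
    · refine Finset.sum_congr rfl fun i _ => ?_
      have h2 : ¬ k + i + 1 ≤ k := by omega
      have h3 : k + i + 1 - k = i + 1 := by omega
      simp only [h2, if_false, h3]
      rcases Nat.eq_zero_or_pos i with rfl | hi
      · simp [hk, hu]
      · have h1 : ¬ k + i ≤ k := by omega
        have h4 : k + i - k = i := by omega
        simp only [h1, if_false, h4]

theorem eq_of_preDist_eq_zero {x y : MetricInversion p} (h : preDist x y = 0) : x = y := by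
  rcases x with _ | x <;> rcases y with _ | y <;> simp only [preDist] at h
  · rfl
  · exact absurd h (one_div_pos.2 (dist_pos.2 y.2)).ne'
  · exact absurd h (one_div_pos.2 (dist_pos.2 x.2)).ne'
  · have hx : 0 < dist x.1 p := dist_pos.2 x.2
    have hy : 0 < dist y.1 p := dist_pos.2 y.2
    have : dist x.1 y.1 = 0 := by
      rcases div_eq_zero_iff.1 h with h | h
      · exact h
      · exact absurd h (mul_pos hx hy).ne'
    rw [Subtype.ext (dist_eq_zero.1 this)]

/-- The metric inversion of `X` at `p`, that is `(X ∪ {∞}) \ {p}` with the distance `d_p`. -/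
noncomputable instance instMetricSpace : MetricSpace (MetricInversion p) where
  dist := invDist
  dist_self x := by
    have h1 := invDist_le x x
    have h2 := quarter_le_invDist x x
    rw [preDist_self] at h1 h2
    linarith
  dist_comm x y := by
    have h : chainSums x y = chainSums y x :=
      Set.ext fun _ => ⟨mem_chainSums_comm, mem_chainSums_comm⟩
    change sInf (chainSums x y) = sInf (chainSums y x)
    rw [h]
  dist_triangle x y w := by
    refine le_of_forall_pos_le_add fun ε hε => ?_
    obtain ⟨r, hr, hr'⟩ := exists_lt_of_csInf_lt ⟨_, preDist_mem_chainSums x y⟩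
      (lt_add_of_pos_right (invDist x y) (half_pos hε))
    obtain ⟨s, hs, hs'⟩ := exists_lt_of_csInf_lt ⟨_, preDist_mem_chainSums y w⟩
      (lt_add_of_pos_right (invDist y w) (half_pos hε))
    have := csInf_le (bddBelow_chainSums x w) (add_mem_chainSums hr hs)
    change invDist x w ≤ _ at this
    linarith
  eq_of_dist_eq_zero {x y} h := by
    have h0 : invDist x y = 0 := h
    have h1 := quarter_le_invDist x y
    have h2 := preDist_nonneg x y
    exact eq_of_preDist_eq_zero (by linarith)

end MetricInversion

/-- `X` is inversion invariant bi-Lipschitz homogeneous: both `X` and its metric inversion at a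
point `p` are uniformly bi-Lipschitz homogeneous. (The notion does not depend on `p`; with the
existential quantifier its negation asserts the failure at every base point.) -/
def IsInversionInvariantBiLipschitzHomogeneous (X : Type*) [MetricSpace X] : Prop :=
  ∃ p : X, IsUniformlyBiLipschitzHomogeneous X ∧
    IsUniformlyBiLipschitzHomogeneous (MetricInversion p)

/-- The cylinder `Γ × ℝ` over a planar set `Γ`, as a subset of Euclidean 3-space. -/
def curveCylinder (Γ : Set (EuclideanSpace ℝ (Fin 2))) : Set (EuclideanSpace ℝ (Fin 3)) :=
  {v | !₂[v 0, v 1] ∈ Γ}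

/-! Put `α = 1/Q`, so `1/2 < α < 1`. A Koch-type curve `φ` with `|φ s - φ t|` comparable to `|s -
t|^α` makes `Γ` a snowflaked line and `S` the plane with distance comparable to `|s - s'|^α + |t -
t'|` (`comparable_cylinder`). The positive claims follow: translations preserve these model
distances, the maps `(s, t) ↦ (λ^(1/α) s, λ t)` multiply the second one by `λ`, and Lebesgue measure
on the parameter line corresponds to Hausdorff measure of dimension `1/α = Q`.

The failure of inversion invariance comes from rectifiable curves. Away from `∞` the coordinate `s`
is Hölder of exponent `1/α > 1`, so it is constant along Lipschitz curves that avoid `∞`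
(`lineCoord_eq_of_lipschitz`). In the inversion, each line `{s} × ℝ`, apart from one level of `t`,
closes up through `∞` as a Lipschitz curve (`closedLine_lipschitz`). If a bi-Lipschitz `f` sent `∞`
to a finite point `q`, then `f⁻¹` would carry the closed lines missing `q` to Lipschitz curves that
avoid `∞` and all pass through `f⁻¹(∞)`, hence into a single line. By density all points except `q`
would go into that line, contradicting surjectivity (`not_homogeneous`). -/

open ComplexConjugate in
/-- The generator of the Koch curve with apex `a`: it replaces a curve by two reflected copies. -/
noncomputable def kochStep (a : ℂ) (f : ℝ → ℂ) (t : ℝ) : ℂ :=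
  if t ≤ 1 / 2 then a * conj (f (2 * t)) else a + (1 - a) * conj (f (2 * t - 1))

/-- The apex of the isosceles triangle over `[0, 1]` whose legs have slope `± k`. -/
noncomputable def kochApex (k : ℝ) : ℂ := ⟨1 / 2, k / 2⟩

/-- The isosceles triangle over `[0, 1]` whose legs have slope `± k`. -/
def kochTriangle (k : ℝ) : Set ℂ :=
  {z | 0 ≤ z.im ∧ z.im ≤ k * z.re ∧ z.im ≤ k * (1 - z.re)}

/-! ### Koch arcs and bi-Hölder lines in the plane -/

namespace Koch

open ComplexConjugate Filter Topology

theorem norm_apex_sq (k : ℝ) : ‖kochApex k‖ ^ 2 = (1 + k ^ 2) / 4 := by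
  rw [← Complex.normSq_eq_norm_sq, Complex.normSq_apply, kochApex]
  ring

theorem norm_one_sub_apex (k : ℝ) : ‖1 - kochApex k‖ = ‖kochApex k‖ := by
  have : ‖1 - kochApex k‖ ^ 2 = ‖kochApex k‖ ^ 2 := by
    rw [← Complex.normSq_eq_norm_sq, ← Complex.normSq_eq_norm_sq, Complex.normSq_apply,
      Complex.normSq_apply]
    simp only [kochApex, Complex.sub_re, Complex.sub_im, Complex.one_re, Complex.one_im]
    ring
  exact (sq_eq_sq₀ (norm_nonneg _) (norm_nonneg _)).1 this

theorem isClosed_kochTriangle (k : ℝ) : IsClosed (kochTriangle k) := by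
  have h1 : Continuous fun z : ℂ => z.re := Complex.continuous_re
  have h2 : Continuous fun z : ℂ => z.im := Complex.continuous_im
  refine (isClosed_le continuous_const h2).inter
    ((isClosed_le h2 (by fun_prop)).inter (isClosed_le h2 (by fun_prop)))

/-- The conjugation lays each scaled copy of the triangle on the inner side of its leg, with its own
apex on the base, at `‖a‖²` or `1 - ‖a‖²`. -/
theorem kochStep_mem {k : ℝ} (h0 : 0 < k) (h1 : k < 1) {f : ℝ → ℂ}
    (hf : ∀ t, f t ∈ kochTriangle k) (t : ℝ) : kochStep (kochApex k) f t ∈ kochTriangle k := by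
  unfold kochStep
  split_ifs
  · obtain ⟨h, h', h''⟩ := hf (2 * t)
    refine ⟨?_, ?_, ?_⟩ <;>
      simp only [kochApex, Complex.mul_re, Complex.mul_im, Complex.conj_re, Complex.conj_im] <;>
      nlinarith [mul_nonneg h0.le h, mul_nonneg h (sub_nonneg.2 h1.le)]
  · obtain ⟨h, h', h''⟩ := hf (2 * t - 1)
    refine ⟨?_, ?_, ?_⟩ <;>
      simp only [kochApex, Complex.mul_re, Complex.mul_im, Complex.conj_re, Complex.conj_im,
        Complex.add_re, Complex.add_im, Complex.sub_re, Complex.sub_im, Complex.one_re,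
        Complex.one_im] <;>
      nlinarith [mul_nonneg h0.le h, mul_nonneg h (sub_nonneg.2 h1.le)]

/-- Both similarities have ratio `‖a‖`; for `‖a‖ < 1` the generator is a uniform contraction and its
iterates converge geometrically. -/
theorem norm_kochStep_sub_le (k : ℝ) {f g : ℝ → ℂ} {B : ℝ} (h : ∀ t, ‖f t - g t‖ ≤ B) (t : ℝ) :
    ‖kochStep (kochApex k) f t - kochStep (kochApex k) g t‖ ≤ ‖kochApex k‖ * B := by
  unfold kochStep
  split_ifs
  · rw [← mul_sub, ← map_sub, norm_mul, RCLike.norm_conj]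
    exact mul_le_mul_of_nonneg_left (h _) (norm_nonneg _)
  · rw [add_sub_add_left_eq_sub, ← mul_sub, ← map_sub, norm_mul, RCLike.norm_conj,
      norm_one_sub_apex]
    exact mul_le_mul_of_nonneg_left (h _) (norm_nonneg _)

theorem norm_apex_lt_one {k : ℝ} (h0 : 0 < k) (h1 : k < 1) : ‖kochApex k‖ < 1 := by
  have := norm_apex_sq k
  have := norm_nonneg (kochApex k)
  nlinarith

/-- The Koch curve: a parametrized curve in the triangle fixed by the generator. -/
theorem exists_fixed {k : ℝ} (h0 : 0 < k) (h1 : k < 1) :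
    ∃ f : ℝ → ℂ, (∀ t, f t ∈ kochTriangle k) ∧ ∀ t, f t = kochStep (kochApex k) f t := by
  set a := kochApex k
  let F : ℕ → ℝ → ℂ := fun n => (kochStep a)^[n] 0
  have hF : ∀ n, F (n + 1) = kochStep a (F n) := fun n => Function.iterate_succ_apply' _ _ _
  have hmem : ∀ n t, F n t ∈ kochTriangle k := by
    intro n
    induction n with
    | zero => intro t; exact ⟨by simp [F], by simp [F], by simp [F, h0.le]⟩
    | succ n ih => rw [hF]; exact kochStep_mem h0 h1 ih
  have hd : ∀ n t, ‖F n t - F (n + 1) t‖ ≤ ‖a‖ * ‖a‖ ^ n := by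
    intro n
    induction n with
    | zero =>
      intro t
      rw [hF]
      simp only [F, kochStep]
      split_ifs <;> simp
    | succ n ih =>
      intro t
      rw [hF (n + 1)]
      nth_rw 1 [hF n]
      refine (norm_kochStep_sub_le k ih t).trans_eq ?_
      ring
  have hlim : ∀ t, ∃ z, Tendsto (fun n => F n t) atTop (𝓝 z) := fun t =>
    cauchySeq_tendsto_of_complete (cauchySeq_of_le_geometric ‖a‖ ‖a‖ (norm_apex_lt_one h0 h1)
      fun n => by rw [dist_eq_norm]; exact hd n t)
  choose f hf using hlim
  refine ⟨f, fun t => (isClosed_kochTriangle k).mem_of_tendsto (hf t)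
    (Eventually.of_forall fun n => hmem n t), fun t => ?_⟩
  refine tendsto_nhds_unique ((tendsto_add_atTop_iff_nat 1).2 (hf t)) ?_
  simp only [hF]
  unfold kochStep
  split_ifs
  · exact ((Complex.continuous_conj.tendsto _).comp (hf _)).const_mul _
  · exact (((Complex.continuous_conj.tendsto _).comp (hf _)).const_mul _).const_add _

/-- A function on `[0, 1]` scaling by `2 ^ (-α)` under halving of the argument is comparable to
`t ^ α`. -/
theorem scaling_bounds {α m M : ℝ} (hα : 0 < α) (hm : 0 ≤ m) (hM : 0 ≤ M) {g : ℝ → ℝ}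
    (h0 : g 0 = 0)
    (hs : ∀ t, 0 ≤ t → t ≤ 1 / 2 → g t = 2 ^ (-α) * g (2 * t))
    (hb : ∀ t, 1 / 2 ≤ t → t ≤ 1 → m ≤ g t ∧ g t ≤ M) {t : ℝ} (ht0 : 0 ≤ t) (ht1 : t ≤ 1) :
    m * t ^ α ≤ g t ∧ g t ≤ M * 2 ^ α * t ^ α := by
  rcases ht0.eq_or_lt with rfl | hpos
  · simp [h0, Real.zero_rpow hα.ne']
  obtain ⟨n, hn⟩ := exists_pow_lt_of_lt_one hpos (by norm_num : (1 / 2 : ℝ) < 1)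
  induction n generalizing t with
  | zero => simp at hn; linarith
  | succ n ih =>
    rcases le_total (1 / 2) t with h | h
    · obtain ⟨h1, h2⟩ := hb t h ht1
      constructor
      · have := Real.rpow_le_one ht0 ht1 hα.le
        nlinarith
      · refine h2.trans ?_
        have : 1 ≤ (2 * t) ^ α := Real.one_le_rpow (by linarith) hα.le
        rw [mul_assoc, ← Real.mul_rpow (by norm_num) ht0]
        nlinarith
    · obtain ⟨h1, h2⟩ := ih (t := 2 * t) (by linarith) (by linarith) (by linarith)
        (by rw [pow_succ] at hn; linarith)
      rw [hs t ht0 h]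
      have e : (2 * t) ^ α = 2 ^ α * t ^ α := Real.mul_rpow (by norm_num) ht0
      have e2 : (2 : ℝ) ^ (-α) * 2 ^ α = 1 := by
        rw [← Real.rpow_add (by norm_num)]; simp
      have hp : (0 : ℝ) < 2 ^ (-α) := by positivity
      rw [e] at h1 h2
      constructor
      · calc m * t ^ α = 2 ^ (-α) * (m * (2 ^ α * t ^ α)) := by linear_combination -(m * t ^ α) * e2
          _ ≤ _ := by gcongr
      · calc _ ≤ 2 ^ (-α) * (M * 2 ^ α * (2 ^ α * t ^ α)) := by gcongr
          _ = M * 2 ^ α * t ^ α := by linear_combination (M * 2 ^ α * t ^ α) * e2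

/-- Slopes below `1` bound heights by horizontal distances to either end of the base, so real parts
control norms. -/
theorem norm_le_two_mul_re {k : ℝ} (h1 : k < 1) {z : ℂ} (hz : z ∈ kochTriangle k)
    (h0 : 0 < k) : ‖z‖ ≤ 2 * z.re ∧ ‖z - 1‖ ≤ 2 * (1 - z.re) ∧ 0 ≤ z.re ∧ z.re ≤ 1 := by
  obtain ⟨h, h', h''⟩ := hz
  have hx : 0 ≤ z.re := by by_contra hc; nlinarith
  have hx' : z.re ≤ 1 := by by_contra hc; nlinarith
  refine ⟨?_, ?_, hx, hx'⟩
  · have := Complex.norm_le_abs_re_add_abs_im z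
    rw [abs_of_nonneg hx, abs_of_nonneg h] at this
    nlinarith
  · have := Complex.norm_le_abs_re_add_abs_im (z - 1)
    simp only [Complex.sub_re, Complex.one_re, Complex.sub_im, Complex.one_im, sub_zero] at this
    rw [abs_of_nonpos (by linarith), abs_of_nonneg h] at this
    nlinarith

/-- The two halves of the Koch curve leave the apex in separated directions. -/
theorem separation {k : ℝ} (h0 : 0 < k) (h1 : k < 1) {z w : ℂ} (hz : z ∈ kochTriangle k)
    (hw : w ∈ kochTriangle k) :
    (1 - k ^ 2) / 4 * (‖z‖ + ‖w - 1‖) ≤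
      ((1 - kochApex k) * conj z - kochApex k * conj (w - 1)).re := by
  have b1 := (norm_le_two_mul_re h1 hz h0).1
  have b2 := (norm_le_two_mul_re h1 hw h0).2.1
  obtain ⟨c1, c2, c3⟩ := hz
  obtain ⟨d1, d2, d3⟩ := hw
  have hδ : 0 ≤ (1 - k ^ 2) / 4 := by nlinarith
  have := mul_le_mul_of_nonneg_left (add_le_add b1 b2) hδ
  refine this.trans ?_
  simp only [kochApex, Complex.mul_re, Complex.conj_re, Complex.conj_im, Complex.sub_re,
    Complex.sub_im, Complex.one_re, Complex.one_im]
  -- With `u = 1 - w.re`, the real part is `(z.re - k * z.im) / 2 + (u - k * w.im) / 2`, and the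
  -- legs give `z.im ≤ k * z.re`, `w.im ≤ k * u`.
  have e1 := mul_le_mul_of_nonneg_left c2 h0.le
  have e2 := mul_le_mul_of_nonneg_left d3 h0.le
  linarith

set_option maxHeartbeats 1000000 in
/-- The Koch curve is a bi-Hölder arc, from `0` to `1`. -/
theorem exists_arc {α : ℝ} (hα : 1 / 2 < α) (hα1 : α < 1) :
    ∃ (c C : ℝ) (f : ℝ → ℂ), 0 < c ∧ 0 < C ∧
      (∀ t, 0 ≤ t → t ≤ 1 → c * t ^ α ≤ (f t).re) ∧
      f 0 = 0 ∧
      (∀ t, 0 ≤ t → t ≤ 1 / 4 → f t = ((4 ^ (-α) : ℝ) : ℂ) * f (4 * t)) ∧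
      ∀ s t, 0 ≤ s → s ≤ t → t ≤ 1 →
        c * (t - s) ^ α ≤ ‖f t - f s‖ ∧ ‖f t - f s‖ ≤ C * (t - s) ^ α := by
  have hα0 : 0 < α := by linarith
  -- Solves `(1 + k²) / 4 = 4^(-α)`, so that both pieces shrink by `2^(-α)`; `α < 1` gives `k > 0`,
  -- and `α > 1/2` gives `k < 1`.
  set k := √((4 : ℝ) ^ (1 - α) - 1) with hk
  have hp1 : (1 : ℝ) < 4 ^ (1 - α) := Real.one_lt_rpow (by norm_num) (by linarith)
  have hp2 : (4 : ℝ) ^ (1 - α) < 2 := by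
    calc (4 : ℝ) ^ (1 - α) < 4 ^ (1 / 2 : ℝ) :=
          Real.rpow_lt_rpow_of_exponent_lt (by norm_num) (by linarith)
      _ = 2 := by
        rw [show (4 : ℝ) = 2 ^ (2 : ℝ) by norm_num, ← Real.rpow_mul (by norm_num)]; norm_num
  have h0 : 0 < k := Real.sqrt_pos.2 (by linarith)
  have hk2 : k ^ 2 = 4 ^ (1 - α) - 1 := Real.sq_sqrt (by linarith)
  have h1 : k < 1 := by nlinarith
  have h4 : ((2 : ℝ) ^ (-α)) ^ 2 = 4 ^ (-α) := by
    rw [show (4 : ℝ) = 2 * 2 by norm_num, Real.mul_rpow (by norm_num) (by norm_num)]; ring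
  have hna : ‖kochApex k‖ = 2 ^ (-α) := by
    refine (sq_eq_sq₀ (norm_nonneg _) (by positivity)).1 ?_
    rw [norm_apex_sq, hk2, h4, show 1 - α = 1 + -α by ring, Real.rpow_add (by norm_num),
      Real.rpow_one]
    ring
  obtain ⟨f, hmem, hfix⟩ := exists_fixed h0 h1
  set a := kochApex k with ha
  have hρ1 : ‖a‖ < 1 := norm_apex_lt_one h0 h1
  have hL : ∀ t ≤ 1 / 2, f t = a * conj (f (2 * t)) := fun t ht => by
    rw [hfix t]; simp only [kochStep, if_pos ht]
  have hR' : ∀ t > 1 / 2, f t = a + (1 - a) * conj (f (2 * t - 1)) := fun t ht => by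
    rw [hfix t]; simp only [kochStep, if_neg (not_le.2 ht)]
  have hf0 : f 0 = 0 := by
    have := congrArg norm (hL 0 (by norm_num))
    rw [norm_mul, RCLike.norm_conj, mul_zero] at this
    have h' := norm_nonneg (f 0)
    exact norm_eq_zero.1 (by nlinarith)
  have hf1 : f 1 = 1 := by
    have h := hR' 1 (by norm_num)
    rw [show (2 : ℝ) * 1 - 1 = 1 by norm_num] at h
    have h2 : f 1 - 1 = (1 - a) * conj (f 1 - 1) := by
      rw [map_sub, map_one]; linear_combination h
    have := congrArg norm h2
    rw [norm_mul, RCLike.norm_conj, norm_one_sub_apex] at this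
    have h' := norm_nonneg (f 1 - 1)
    exact sub_eq_zero.1 (norm_eq_zero.1 (by nlinarith))
  -- At `t = 1/2` both formulas give the apex, because the arc runs from `0` to `1`.
  have hR : ∀ t ≥ 1 / 2, f t = a + (1 - a) * conj (f (2 * t - 1)) := fun t ht => by
    rcases ht.eq_or_lt with h | h
    · rw [hL t h.ge, ← h]; norm_num [hf0, hf1]
    · exact hR' t h
  have hz : ∀ t, 0 ≤ t → t ≤ 1 → 1 / 2 * t ^ α ≤ ‖f t‖ ∧ ‖f t‖ ≤ 2 * 2 ^ α * t ^ α := by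
    intro t ht0 ht1
    refine scaling_bounds hα0 (by norm_num) (by norm_num) (g := fun t => ‖f t‖) (by simp [hf0])
      (fun t _ ht => ?_) (fun t ht _ => ?_) ht0 ht1
    · rw [hL t ht, norm_mul, RCLike.norm_conj, hna]
    · obtain ⟨b1, b2, b3, b4⟩ := norm_le_two_mul_re h1 (hmem t) h0
      refine ⟨le_trans ?_ (Complex.re_le_norm _), by linarith⟩
      obtain ⟨c1, c2, c3⟩ := hmem (2 * t - 1)
      rw [hR t ht]
      simp only [a, kochApex, Complex.mul_re, Complex.conj_re, Complex.conj_im, Complex.add_re,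
        Complex.sub_re, Complex.sub_im, Complex.one_re, Complex.one_im]
      nlinarith
  have ho : ∀ t, 0 ≤ t → t ≤ 1 →
      1 / 2 * t ^ α ≤ ‖f (1 - t) - 1‖ ∧ ‖f (1 - t) - 1‖ ≤ 2 * 2 ^ α * t ^ α := by
    intro t ht0 ht1
    refine scaling_bounds hα0 (by norm_num) (by norm_num) (g := fun t => ‖f (1 - t) - 1‖)
      (by simp [hf1]) (fun t _ ht => ?_) (fun t ht _ => ?_) ht0 ht1
    · have : f (1 - t) - 1 = (1 - a) * conj (f (1 - 2 * t) - 1) := by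
        rw [hR (1 - t) (by linarith), map_sub, map_one,
          show 2 * (1 - t) - 1 = 1 - 2 * t by ring]
        ring
      simp only [this]
      rw [norm_mul, RCLike.norm_conj, norm_one_sub_apex, hna]
    · obtain ⟨b1, b2, b3, b4⟩ := norm_le_two_mul_re h1 (hmem (1 - t)) h0
      refine ⟨?_, by linarith⟩
      rw [norm_sub_rev]
      refine le_trans ?_ (Complex.re_le_norm _)
      obtain ⟨c1, c2, c3⟩ := hmem (2 * (1 - t))
      rw [hL (1 - t) (by linarith)]
      simp only [a, kochApex, Complex.mul_re, Complex.conj_re, Complex.conj_im,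
        Complex.sub_re, Complex.one_re]
      nlinarith
  -- Half the constant in `separation`: the other half pays for the factor `1/2` in the lower bounds
  -- `hz` and `ho`.
  set δ := (1 - k ^ 2) / 8 with hδ
  have hδ0 : 0 < δ := by rw [hδ]; nlinarith
  have hδ1 : δ ≤ 1 / 4 := by rw [hδ]; nlinarith
  have e2 : (2 : ℝ) ^ (-α) * 2 ^ α = 1 := by rw [← Real.rpow_add (by norm_num)]; simp
  refine ⟨δ, 4 * 2 ^ α, f, hδ0, by positivity, ?_, hf0, ?_, ?_⟩
  · intro t ht0 ht1
    have b1 := (norm_le_two_mul_re h1 (hmem t) h0).1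
    have b2 := (hz t ht0 ht1).1
    have b3 : 0 ≤ t ^ α := by positivity
    nlinarith
  · intro t ht0 ht1
    -- Two halvings cancel the reflection and the rotation: `a * conj a = ‖a‖²` is a positive
    -- scalar. Hence self-similarity is recorded for quarters.
    rw [hL t (by linarith), hL (2 * t) (by linarith), map_mul, Complex.conj_conj, ← mul_assoc,
      Complex.mul_conj, Complex.normSq_eq_norm_sq, hna, h4, show 2 * (2 * t) = 4 * t by ring]
  · intro s t hs hst ht
    rcases hst.eq_or_lt with rfl | hlt
    · simp [Real.zero_rpow hα0.ne']
    -- Induction on the scale: if `s` and `t` lie in the same half, rescaling doubles `t - s`; if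
    -- they straddle `1/2`, compare with the apex directly.
    obtain ⟨n, hn⟩ := exists_pow_lt_of_lt_one (sub_pos.2 hlt) (by norm_num : (1 / 2 : ℝ) < 1)
    have key : ∀ x ≥ 0, ∀ y : ℝ, (δ * (2 * x) ^ α ≤ y ∧ y ≤ 4 * 2 ^ α * (2 * x) ^ α) →
        δ * x ^ α ≤ 2 ^ (-α) * y ∧ 2 ^ (-α) * y ≤ 4 * 2 ^ α * x ^ α := by
      rintro x hx y ⟨h, h'⟩
      rw [Real.mul_rpow (by norm_num) hx] at h h'
      have hp : (0 : ℝ) < 2 ^ (-α) := by positivity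
      constructor
      · calc δ * x ^ α = 2 ^ (-α) * (δ * (2 ^ α * x ^ α)) := by linear_combination -(δ * x ^ α) * e2
          _ ≤ _ := by gcongr
      · calc _ ≤ 2 ^ (-α) * (4 * 2 ^ α * (2 ^ α * x ^ α)) := by gcongr
          _ = 4 * 2 ^ α * x ^ α := by linear_combination (4 * 2 ^ α * x ^ α) * e2
    induction n generalizing s t with
    | zero => simp at hn; linarith
    | succ n ih =>
      rw [pow_succ] at hn
      rcases le_total t (1 / 2) with h | h
      · have := ih (2 * s) (2 * t) (by linarith) (by linarith) (by linarith) (by linarith)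
          (by linarith)
        rw [hL t h, hL s (by linarith), ← mul_sub, ← map_sub, norm_mul, RCLike.norm_conj, hna]
        refine key _ (by linarith) _ ?_
        convert this using 4 <;> ring
      rcases le_total (1 / 2) s with h' | h'
      · have := ih (2 * s - 1) (2 * t - 1) (by linarith) (by linarith) (by linarith) (by linarith)
          (by linarith)
        rw [hR t h, hR s h', add_sub_add_left_eq_sub, ← mul_sub, ← map_sub, norm_mul,
          RCLike.norm_conj, norm_one_sub_apex, hna]
        refine key _ (by linarith) _ ?_
        convert this using 4 <;> ring
      · have hS := ho (1 - 2 * s) (by linarith) (by linarith)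
        rw [sub_sub_cancel] at hS
        have hT := hz (2 * t - 1) (by linarith) (by linarith)
        have e : f t - f s = (1 - a) * conj (f (2 * t - 1)) - a * conj (f (2 * s) - 1) := by
          rw [hL s h', hR t h, map_sub, map_one]; ring
        constructor
        · have hre : 2 * δ * (‖f (2 * t - 1)‖ + ‖f (2 * s) - 1‖) ≤ (f t - f s).re := by
            rw [e, show 2 * δ = (1 - k ^ 2) / 4 by rw [hδ]; ring]
            exact separation h0 h1 (hmem _) (hmem _)
          refine le_trans ?_ (hre.trans (Complex.re_le_norm _))
          have hsub : (t - s) ^ α ≤ (2 * t - 1) ^ α + (1 - 2 * s) ^ α :=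
            calc (t - s) ^ α ≤ ((2 * t - 1) + (1 - 2 * s)) ^ α :=
                  Real.rpow_le_rpow (by linarith) (by linarith) hα0.le
              _ ≤ _ := Real.rpow_add_le_add_rpow (by linarith) (by linarith) hα0.le hα1.le
          nlinarith
        · have u1 : (2 * t - 1) ^ α ≤ 2 ^ α * (t - s) ^ α := by
            rw [← Real.mul_rpow (by norm_num) (by linarith)]
            exact Real.rpow_le_rpow (by linarith) (by linarith) hα0.le
          have u2 : (1 - 2 * s) ^ α ≤ 2 ^ α * (t - s) ^ α := by
            rw [← Real.mul_rpow (by norm_num) (by linarith)]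
            exact Real.rpow_le_rpow (by linarith) (by linarith) hα0.le
          rw [e]
          refine (norm_sub_le _ _).trans ?_
          rw [norm_mul, norm_mul, RCLike.norm_conj, RCLike.norm_conj, norm_one_sub_apex, hna]
          have hp : (0 : ℝ) < 2 ^ (-α) := by positivity
          calc 2 ^ (-α) * ‖f (2 * t - 1)‖ + 2 ^ (-α) * ‖f (2 * s) - 1‖
              ≤ 2 ^ (-α) * (2 * 2 ^ α * (2 ^ α * (t - s) ^ α)) +
                2 ^ (-α) * (2 * 2 ^ α * (2 ^ α * (t - s) ^ α)) := by
                gcongr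
                · exact hT.2.trans (by gcongr)
                · exact hS.2.trans (by gcongr)
            _ = 4 * 2 ^ α * (t - s) ^ α := by
                linear_combination (4 * 2 ^ α * (t - s) ^ α) * e2

end Koch

/-- `φ` is a bi-Hölder parametrization with exponent `α`: it embeds the snowflaked line
`(ℝ, |s - t| ^ α)` up to the constants `c` and `C`. -/
def IsSnowflakeLine {E : Type*} [MetricSpace E] (α c C : ℝ) (φ : ℝ → E) : Prop :=
  0 < c ∧ 0 < C ∧
    ∀ s t, c * |s - t| ^ α ≤ dist (φ s) (φ t) ∧ dist (φ s) (φ t) ≤ C * |s - t| ^ α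

namespace Koch

/-- The blow-up of a self-similar arc at its initial point is a bi-Hölder half line. -/
theorem exists_halfLine {α : ℝ} (hα : 1 / 2 < α) (hα1 : α < 1) :
    ∃ (c C : ℝ) (f : ℝ → ℂ), 0 < c ∧ 0 < C ∧ f 0 = 0 ∧ (∀ t, 0 ≤ t → c * t ^ α ≤ (f t).re) ∧
      ∀ s t, 0 ≤ s → s ≤ t →
        c * (t - s) ^ α ≤ ‖f t - f s‖ ∧ ‖f t - f s‖ ≤ C * (t - s) ^ α := by
  obtain ⟨c, C, f, hc, hC, hre, h0, hs, hb⟩ := exists_arc hα hα1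
  -- `g n` is the arc magnified to the parameter interval `[0, 4^n]`. By self-similarity `g (n + 1)`
  -- extends it, and the index `⌈t⌉₊` is always large enough since `t ≤ 4 ^ ⌈t⌉₊`.
  let g : ℕ → ℝ → ℂ := fun n t => ((((4 : ℝ) ^ α) ^ n : ℝ) : ℂ) * f (t / 4 ^ n)
  have hstep : ∀ n t, 0 ≤ t → t ≤ 4 ^ n → g (n + 1) t = g n t := by
    intro n t ht ht'
    have hp : (0 : ℝ) < 4 ^ n := by positivity
    have e : ((4 : ℝ) ^ α) ^ (n + 1) * 4 ^ (-α) = (4 ^ α) ^ n := by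
      rw [pow_succ, mul_assoc, ← Real.rpow_add (by norm_num)]; simp
    simp only [g]
    rw [hs (t / 4 ^ (n + 1)) (by positivity), ← mul_assoc, ← Complex.ofReal_mul, e, pow_succ]
    · congr 2
      field_simp
    · rw [pow_succ, div_le_div_iff₀ (by positivity) (by norm_num)]
      linarith
  have hmono : ∀ n m t, n ≤ m → 0 ≤ t → t ≤ 4 ^ n → g m t = g n t := by
    intro n m t hnm ht ht'
    induction m, hnm using Nat.le_induction with
    | base => rfl
    | succ m hm ih =>
      rw [hstep m t ht (ht'.trans (pow_le_pow_right₀ (by norm_num) hm)), ih]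
  have hceil : ∀ t : ℝ, t ≤ 4 ^ ⌈t⌉₊ := fun t =>
    (Nat.le_ceil t).trans (by exact_mod_cast (Nat.lt_pow_self (by norm_num)).le)
  have hscale : ∀ n : ℕ, ∀ x : ℝ, 0 ≤ x → ((4 : ℝ) ^ α) ^ n * (x / 4 ^ n) ^ α = x ^ α := by
    intro n x hx
    rw [Real.div_rpow hx (by positivity), ← Real.rpow_natCast_mul (by norm_num),
      ← Real.rpow_mul_natCast (by norm_num), mul_comm α]
    have : (0 : ℝ) < 4 ^ ((n : ℝ) * α) := by positivity
    field_simp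
  refine ⟨c, C, fun t => g ⌈t⌉₊ t, hc, hC, by simp [g, h0], fun t ht => ?_,
    fun s t hs0 hst => ?_⟩
  · have hp : (0 : ℝ) < (4 ^ α) ^ ⌈t⌉₊ := by positivity
    have := hre (t / 4 ^ ⌈t⌉₊) (by positivity) ((div_le_one (by positivity)).2 (hceil t))
    simp only [g]
    rw [Complex.re_ofReal_mul]
    calc c * t ^ α = (4 ^ α) ^ ⌈t⌉₊ * (c * (t / 4 ^ ⌈t⌉₊) ^ α) := by
          rw [← hscale ⌈t⌉₊ t ht]; ring
      _ ≤ _ := by gcongr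
  · set n := ⌈t⌉₊
    have hn : ⌈s⌉₊ ≤ n := Nat.ceil_mono hst
    have hst' : s ≤ 4 ^ n := hst.trans (hceil t)
    have hpn : (0 : ℝ) < 4 ^ n := by positivity
    have hp : (0 : ℝ) < (4 ^ α) ^ n := by positivity
    beta_reduce
    rw [← hmono _ n s hn hs0 (hceil s)]
    obtain ⟨b1, b2⟩ := hb (s / 4 ^ n) (t / 4 ^ n) (by positivity) (by gcongr)
      ((div_le_one hpn).2 (hceil t))
    rw [← sub_div] at b1 b2
    simp only [g]
    rw [← mul_sub, norm_mul, Complex.norm_real, Real.norm_of_nonneg hp.le]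
    rw [← hscale n (t - s) (by linarith)]
    constructor
    · calc _ = (4 ^ α) ^ n * (c * ((t - s) / 4 ^ n) ^ α) := by ring
        _ ≤ _ := by gcongr
    · calc _ ≤ (4 ^ α) ^ n * (C * ((t - s) / 4 ^ n) ^ α) := by gcongr
        _ = _ := by ring

/-- Every exponent in `(1/2, 1)` is that of a bi-Hölder line in the plane. -/
theorem exists_isSnowflakeLine {α : ℝ} (hα : 1 / 2 < α) (hα1 : α < 1) :
    ∃ (c C : ℝ) (φ : ℝ → EuclideanSpace ℝ (Fin 2)), IsSnowflakeLine α c C φ := by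
  obtain ⟨c, C, f, hc, hC, h0, hre, hb⟩ := exists_halfLine hα hα1
  have hα0 : 0 < α := by linarith
  let ι := Complex.orthonormalBasisOneI.repr
  -- Odd extension. The bound on `(f t).re` keeps the two halves in opposite half-planes, so across
  -- `0` the real parts add; the triangle inequality there costs the factor `2`.
  let F : ℝ → ℂ := fun t => if 0 ≤ t then f t else -f (-t)
  refine ⟨c, 2 * C, fun t => ι (F t), hc, by positivity, fun s t => ?_⟩
  beta_reduce
  rw [ι.dist_map]
  wlog hst : s ≤ t generalizing s t
  · rw [abs_sub_comm, dist_comm]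
    exact this t s (le_of_not_ge hst)
  rw [abs_sub_comm, abs_of_nonneg (sub_nonneg.2 hst), dist_comm, dist_eq_norm]
  have hC2 : ∀ x : ℝ, 0 ≤ x → C * x ^ α ≤ 2 * C * x ^ α := by
    intro x hx
    have : 0 ≤ C * x ^ α := by positivity
    linarith
  rcases le_or_gt 0 s with hs | hs
  · simp only [F, if_pos hs, if_pos (hs.trans hst)]
    obtain ⟨b1, b2⟩ := hb s t hs hst
    exact ⟨b1, b2.trans (hC2 _ (sub_nonneg.2 hst))⟩
  rcases le_or_gt 0 t with ht | ht
  · simp only [F, if_pos ht, if_neg (not_le.2 hs), sub_neg_eq_add]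
    have r1 := hre t ht
    have r2 := hre (-s) (by linarith)
    have b1 := (hb 0 t le_rfl ht).2
    have b2 := (hb 0 (-s) le_rfl (by linarith)).2
    rw [h0, sub_zero, sub_zero] at b1 b2
    constructor
    · refine le_trans ?_ (Complex.re_le_norm _)
      have : (t + -s) ^ α ≤ t ^ α + (-s) ^ α :=
        Real.rpow_add_le_add_rpow ht (by linarith) hα0.le hα1.le
      rw [← sub_eq_add_neg] at this
      rw [Complex.add_re]
      nlinarith
    · refine (norm_add_le _ _).trans ?_
      have u1 : t ^ α ≤ (t - s) ^ α := Real.rpow_le_rpow ht (by linarith) hα0.le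
      have u2 : (-s) ^ α ≤ (t - s) ^ α := Real.rpow_le_rpow (by linarith) (by linarith) hα0.le
      nlinarith
  · simp only [F, if_neg (not_le.2 ht), if_neg (not_le.2 hs)]
    obtain ⟨b1, b2⟩ := hb (-t) (-s) (by linarith) (by linarith)
    have e : -f (-t) - -f (-s) = f (-s) - f (-t) := by ring
    have e' : -s - -t = t - s := by ring
    rw [e'] at b1 b2
    rw [e]
    exact ⟨b1, b2.trans (hC2 _ (sub_nonneg.2 hst))⟩

end Koch

theorem HolderWith.of_dist_le_rpow {X Y : Type*} [PseudoMetricSpace X] [PseudoMetricSpace Y]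
    {C r : ℝ} (hC : 0 ≤ C) (hr : 0 ≤ r) {f : X → Y}
    (h : ∀ x y, dist (f x) (f y) ≤ C * dist x y ^ r) : HolderWith C.toNNReal r.toNNReal f := by
  intro x y
  rw [edist_dist, edist_dist, Real.coe_toNNReal _ hr,
    ENNReal.ofReal_rpow_of_nonneg dist_nonneg hr, ← ENNReal.ofReal, ← ENNReal.ofReal_mul hC]
  exact ENNReal.ofReal_le_ofReal (h x y)

/-! ### Topology and Hausdorff measure of bi-Hölder lines -/

namespace IsSnowflakeLine

open Filter Topology MeasureTheory Set
open scoped ENNReal NNReal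

variable {E : Type*} [MetricSpace E] {α c C : ℝ} {φ : ℝ → E}

theorem continuous (h : IsSnowflakeLine α c C φ) (hα : 0 < α) : Continuous φ := by
  rw [continuous_iff_continuousAt]
  intro s
  rw [ContinuousAt, tendsto_iff_dist_tendsto_zero]
  refine squeeze_zero (fun _ => dist_nonneg) (fun t => (h.2.2 t s).2) ?_
  have : Continuous fun t : ℝ => C * |t - s| ^ α :=
    continuous_const.mul ((by fun_prop : Continuous fun t : ℝ => |t - s|).rpow_const
      fun _ => Or.inr hα.le)
  simpa [Real.zero_rpow hα.ne'] using this.tendsto s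

theorem injective (h : IsSnowflakeLine α c C φ) : Function.Injective φ := by
  intro s t hst
  by_contra hne
  have h1 := (h.2.2 s t).1
  rw [hst, dist_self] at h1
  have h2 : 0 < |s - t| ^ α := Real.rpow_pos_of_pos (abs_pos.2 (sub_ne_zero.2 hne)) α
  have := mul_pos h.1 h2
  linarith

/-- The lower Hölder bound forces `φ t` out of every bounded set as `|t| → ∞`, so `φ` is a proper
map. -/
theorem isClosedEmbedding [ProperSpace E] (h : IsSnowflakeLine α c C φ) (hα : 0 < α) :
    IsClosedEmbedding φ := by
  refine .of_continuous_injective_isClosedMap (h.continuous hα) h.injective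
    (IsProperMap.isClosedMap ?_)
  rw [isProperMap_iff_tendsto_cocompact]
  refine ⟨h.continuous hα, ?_⟩
  rw [← Metric.cobounded_eq_cocompact, ← Metric.cobounded_eq_cocompact,
    ← Metric.comap_dist_right_atTop (φ 0), tendsto_comap_iff]
  refine tendsto_atTop_mono (fun t => (h.2.2 t 0).1) ?_
  simp only [sub_zero]
  exact ((tendsto_rpow_atTop hα).comp tendsto_norm_cobounded_atTop).const_mul_atTop h.1

/-- The homeomorphism from the line onto a bi-Hölder line. -/
noncomputable def homeo [ProperSpace E] (h : IsSnowflakeLine α c C φ) (hα : 0 < α) :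
    ℝ ≃ₜ range φ :=
  (h.isClosedEmbedding hα).isEmbedding.toHomeomorph

theorem abs_sub_le (h : IsSnowflakeLine α c C φ) (hα : 0 < α) (s t : ℝ) :
    |s - t| ≤ c⁻¹ ^ α⁻¹ * dist (φ s) (φ t) ^ α⁻¹ := by
  have hc := h.1
  rw [← Real.mul_rpow (by positivity) dist_nonneg]
  calc |s - t| = (|s - t| ^ α) ^ α⁻¹ := (Real.rpow_rpow_inv (abs_nonneg _) hα.ne').symm
    _ ≤ _ := by
      refine Real.rpow_le_rpow (by positivity) ?_ (by positivity)
      rw [inv_mul_eq_div, le_div_iff₀ hc, mul_comm]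
      exact (h.2.2 s t).1

/-- A bi-Hölder line of exponent `α` is Ahlfors regular of dimension `1 / α`. -/
theorem isAhlforsRegular [ProperSpace E] [MeasurableSpace E] [BorelSpace E]
    (h : IsSnowflakeLine α c C φ) (hα : 0 < α) : IsAhlforsRegular α⁻¹ (range φ) := by
  have hc := h.1
  have hC := h.2.1
  set e := h.homeo hα
  have hQ : 0 < α⁻¹ := by positivity
  have hval : ∀ t, (e t : E) = φ t := fun _ => rfl
  have hd : ∀ s t, dist (e s) (e t) = dist (φ s) (φ t) := fun _ _ => rfl
  have hH : HolderWith C.toNNReal α.toNNReal e := by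
    refine HolderWith.of_dist_le_rpow hC.le hα.le fun s t => ?_
    rw [hd, Real.dist_eq]
    exact (h.2.2 s t).2
  have hH' : HolderWith (c⁻¹ ^ α⁻¹).toNNReal α⁻¹.toNNReal e.symm := by
    refine HolderWith.of_dist_le_rpow (by positivity) hQ.le fun x y => ?_
    obtain ⟨s, rfl⟩ := e.surjective x
    obtain ⟨t, rfl⟩ := e.surjective y
    rw [hd, e.symm_apply_apply, e.symm_apply_apply, Real.dist_eq]
    exact h.abs_sub_le hα s t
  -- An `α`-Hölder map turns dimension `1` into `1/α`, and its `1/α`-Hölder inverse turns it back;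
  -- `volume` is the one-dimensional Hausdorff measure.
  have up : ∀ s : Set ℝ, μH[α⁻¹] (e '' s) ≤ ENNReal.ofReal (C ^ α⁻¹) * volume s := by
    intro s
    have := (hH.holderOnWith s).hausdorffMeasure_image_le (Real.toNNReal_pos.2 hα) hQ.le
    rwa [Real.coe_toNNReal _ hα.le, mul_inv_cancel₀ hα.ne', hausdorffMeasure_real,
      ← ENNReal.ofReal, ENNReal.ofReal_rpow_of_pos hC] at this
  have low : ∀ s : Set ℝ, volume s ≤ ENNReal.ofReal (c⁻¹ ^ α⁻¹) * μH[α⁻¹] (e '' s) := by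
    intro s
    have := (hH'.holderOnWith (e '' s)).hausdorffMeasure_image_le (Real.toNNReal_pos.2 hQ)
      zero_le_one
    rwa [Real.coe_toNNReal _ hQ.le, mul_one, hausdorffMeasure_real,
      ← ENNReal.ofReal, ENNReal.rpow_one, ← image_comp,
      show (e.symm ∘ e : ℝ → ℝ) = id from funext e.symm_apply_apply, image_id] at this
  set A := C ^ α⁻¹ with hA
  set B := c⁻¹ ^ α⁻¹ with hB
  have hA0 : 0 < A := by positivity
  have hB0 : 0 < B := by positivity
  refine ⟨max 1 (2 * A * B), le_max_left _ _, fun x r hr => ?_⟩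
  obtain ⟨s, rfl⟩ := e.surjective x
  have hrQ : 0 < r ^ α⁻¹ := by positivity
  constructor
  · have hsub : e '' Ioo (s - A⁻¹ * r ^ α⁻¹) (s + A⁻¹ * r ^ α⁻¹) ⊆ Metric.ball (e s) r := by
      rintro _ ⟨t, ht, rfl⟩
      rw [Metric.mem_ball, hd]
      have hts : |t - s| < A⁻¹ * r ^ α⁻¹ := by
        rw [abs_lt]; constructor <;> linarith [ht.1, ht.2]
      have h1 : |t - s| ^ α < (A⁻¹ * r ^ α⁻¹) ^ α := Real.rpow_lt_rpow (abs_nonneg _) hts hα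
      rw [Real.mul_rpow (by positivity) (by positivity), Real.inv_rpow hA0.le,
        hA, Real.rpow_inv_rpow hC.le hα.ne', Real.rpow_inv_rpow hr.le hα.ne'] at h1
      calc dist (φ t) (φ s) ≤ C * |t - s| ^ α := (h.2.2 t s).2
        _ < C * (C⁻¹ * r) := by gcongr
        _ = r := by field_simp
    have h1 := (low (Ioo (s - A⁻¹ * r ^ α⁻¹) (s + A⁻¹ * r ^ α⁻¹))).trans
      (mul_le_mul_right (measure_mono hsub) _)
    rw [Real.volume_Ioo] at h1
    have h2 : ENNReal.ofReal (B⁻¹ * (2 * (A⁻¹ * r ^ α⁻¹))) ≤ μH[α⁻¹] (Metric.ball (e s) r) := by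
      rw [ENNReal.ofReal_mul (by positivity), ENNReal.ofReal_inv_of_pos hB0]
      rw [mul_comm, ← div_eq_mul_inv]
      refine ENNReal.div_le_of_le_mul' ?_
      rwa [show s + A⁻¹ * r ^ α⁻¹ - (s - A⁻¹ * r ^ α⁻¹) = 2 * (A⁻¹ * r ^ α⁻¹) by ring] at h1
    refine le_trans (ENNReal.ofReal_le_ofReal ?_) h2
    have h3 : (max 1 (2 * A * B))⁻¹ ≤ 2 * (A⁻¹ * B⁻¹) := by
      refine (inv_anti₀ (by positivity) (le_max_right _ _)).trans ?_
      rw [mul_inv, mul_inv, mul_assoc]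
      have : 0 < A⁻¹ * B⁻¹ := by positivity
      nlinarith
    calc _ ≤ 2 * (A⁻¹ * B⁻¹) * r ^ α⁻¹ := by gcongr
      _ = _ := by ring
  · have hsub : Metric.ball (e s) r ⊆ e '' Icc (s - B * r ^ α⁻¹) (s + B * r ^ α⁻¹) := by
      intro y hy
      obtain ⟨t, rfl⟩ := e.surjective y
      refine ⟨t, ?_, rfl⟩
      rw [Metric.mem_ball, hd] at hy
      have h1 : |t - s| ≤ B * r ^ α⁻¹ := (h.abs_sub_le hα t s).trans
        (mul_le_mul_of_nonneg_left (Real.rpow_le_rpow dist_nonneg hy.le hQ.le) hB0.le)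
      rw [abs_le] at h1
      constructor <;> linarith [h1.1, h1.2]
    refine (measure_mono hsub).trans ((up _).trans ?_)
    rw [Real.volume_Icc, ← ENNReal.ofReal_mul hA0.le]
    refine ENNReal.ofReal_le_ofReal ?_
    calc _ = 2 * A * B * r ^ α⁻¹ := by ring
      _ ≤ _ := by gcongr; exact le_max_right _ _

end IsSnowflakeLine

/-! ### Transfer of symmetries from a model distance -/

/-- The homeomorphism `e` identifies the distance of `X` with the function `D`, up to the
factor `K`. -/
def IsComparableVia {A X : Type*} [TopologicalSpace A] [MetricSpace X] (K : ℝ) (D : A → A → ℝ)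
    (e : A ≃ₜ X) : Prop :=
  1 ≤ K ∧ ∀ x y, K⁻¹ * D x y ≤ dist (e x) (e y) ∧ dist (e x) (e y) ≤ K * D x y

namespace IsComparableVia

variable {A X : Type*} [TopologicalSpace A] [MetricSpace X] {K : ℝ} {D : A → A → ℝ} {e : A ≃ₜ X}

theorem le_mul_dist (h : IsComparableVia K D e) (x y : A) : D x y ≤ K * dist (e x) (e y) := by
  have hK : 0 < K := zero_lt_one.trans_le h.1
  have := (h.2 x y).1
  rwa [inv_mul_eq_div, div_le_iff₀ hK, mul_comm] at this

/-- The comparison is used once on the way to the model and once on the way back, whence `K ^ 2`,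
whatever `f` and `s` are. -/
theorem scaling (h : IsComparableVia K D e) {f : A ≃ₜ A} {s : ℝ} (hs : 0 ≤ s)
    (hf : ∀ x y, D (f x) (f y) = s * D x y) (a b : X) :
    (K ^ 2)⁻¹ * (s * dist a b) ≤ dist (e (f (e.symm a))) (e (f (e.symm b))) ∧
      dist (e (f (e.symm a))) (e (f (e.symm b))) ≤ K ^ 2 * (s * dist a b) := by
  have hK : 0 < K := zero_lt_one.trans_le h.1
  obtain ⟨x, rfl⟩ := e.surjective a
  obtain ⟨y, rfl⟩ := e.surjective b
  rw [e.symm_apply_apply, e.symm_apply_apply]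
  have h1 := h.2 (f x) (f y)
  rw [hf] at h1
  constructor
  · refine le_trans ?_ h1.1
    calc (K ^ 2)⁻¹ * (s * dist (e x) (e y)) ≤ (K ^ 2)⁻¹ * (s * (K * D x y)) := by
          gcongr; exact (h.2 x y).2
      _ = _ := by field_simp
  · refine h1.2.trans ?_
    calc K * (s * D x y) ≤ K * (s * (K * dist (e x) (e y))) := by
          gcongr; exact h.le_mul_dist x y
      _ = _ := by ring

/-- If the homeomorphisms that preserve `D` are transitive, they act by uniformly bi-Lipschitz
maps. -/
theorem homogeneousGroup (h : IsComparableVia K D e)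
    (ht : ∀ x y : A, ∃ f : A ≃ₜ A, (∀ u v, D (f u) (f v) = D u v) ∧ f x = y) :
    IsUniformlyBiLipschitzHomogeneousGroup X := by
  let conj : (A ≃ₜ A) → (X ≃ₜ X) := fun f => e.symm.trans (f.trans e)
  -- The group is the conjugate of all `D`-preserving homeomorphisms; compositions preserve `D`
  -- exactly, so the constant does not grow.
  refine ⟨K ^ 2,
    { carrier := {g | ∃ f : A ≃ₜ A, (∀ u v, D (f u) (f v) = D u v) ∧ g = conj f}
      mul_mem' := ?_
      one_mem' := ⟨Homeomorph.refl A, fun _ _ => rfl, by ext x; simp [conj]⟩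
      inv_mem' := ?_ }, ?_, ?_⟩
  · rintro _ _ ⟨f, hf, rfl⟩ ⟨f', hf', rfl⟩
    refine ⟨f'.trans f, fun u v => ?_, ?_⟩
    · simp only [Homeomorph.trans_apply, hf, hf']
    · ext x
      simp [conj]
  · rintro _ ⟨f, hf, rfl⟩
    refine ⟨f.symm, fun u v => ?_, ?_⟩
    · conv_rhs => rw [← f.apply_symm_apply u, ← f.apply_symm_apply v, hf]
    · ext x
      rfl
  · rintro _ ⟨f, hf, rfl⟩
    refine ⟨one_le_pow₀ h.1, fun x y => ?_⟩
    have := h.scaling zero_le_one (f := f) (fun u v => by rw [hf, one_mul]) x y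
    rwa [one_mul] at this
  · intro x y
    obtain ⟨f, hf, hxy⟩ := ht (e.symm x) (e.symm y)
    refine ⟨conj f, ⟨f, hf, rfl⟩, ?_⟩
    simp [conj, hxy]

/-- If `D` admits dilations fixing `x`, the space is quasi-self-similar. -/
theorem isQuasiSelfSimilar (h : IsComparableVia K D e) (x : A)
    (ht : ∀ s : ℝ, 1 ≤ s → ∃ f : A ≃ₜ A, f x = x ∧ ∀ u v, D (f u) (f v) = s * D u v) :
    IsQuasiSelfSimilar X := by
  refine ⟨e x, K ^ 2, one_le_pow₀ h.1, fun s hs => ?_⟩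
  obtain ⟨f, hx, hf⟩ := ht s hs
  refine ⟨e.symm.trans (f.trans e), by simp [hx], fun a b => ?_⟩
  exact h.scaling (zero_le_one.trans hs) hf a b

end IsComparableVia

/-! ### Lipschitz curves in the inversion of a snowflake cylinder -/

/-- The distance of the product of the line snowflaked with exponent `α` and the line. -/
noncomputable def snowflakeProdDist (α : ℝ) (x y : ℝ × ℝ) : ℝ :=
  |x.1 - y.1| ^ α + |x.2 - y.2|

namespace MetricInversion

open Filter Topology

variable {X : Type*} [MetricSpace X] {p : X}

theorem dist_le_preDist (x y : MetricInversion p) : dist x y ≤ preDist x y := invDist_le x y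

theorem preDist_le_four_mul_dist (x y : MetricInversion p) : preDist x y ≤ 4 * dist x y := by
  have : preDist x y / 4 ≤ dist x y := quarter_le_invDist x y
  linarith

/-- The point of the inversion given by a point different from the base point. -/
def ofNe (x : {x : X // x ≠ p}) : MetricInversion p := some x

/-- The first coordinate of a point of the inversion, and `0` at `∞`. -/
def lineCoord (e : ℝ × ℝ ≃ₜ X) : MetricInversion p → ℝ
  | some x => (e.symm x.1).1
  | none => 0

variable {e : ℝ × ℝ ≃ₜ X} {K α : ℝ}

/-- Off `∞` the first coordinate is locally Hölder of exponent `1 / α`. -/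
theorem lineCoord_local (h : IsComparableVia K (snowflakeProdDist α) e) (hα : 0 < α)
    {z : MetricInversion p} (hz : z ≠ none) :
    ∃ A > 0, ∃ δ > 0, ∀ w : MetricInversion p, w ≠ none → dist w z ≤ δ →
      |lineCoord e w - lineCoord e z| ≤ (A * dist w z) ^ α⁻¹ := by
  have hK : 0 < K := zero_lt_one.trans_le h.1
  rcases z with _ | z
  · exact absurd rfl hz
  have hd : 0 < dist z.1 p := dist_pos.2 z.2
  -- This radius keeps the reciprocal distance of `w` to `p` at least half that of `z`, so `dist w.1
  -- p ≤ 2 * dist z.1 p` and the inversion distance bounds the original one linearly.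
  refine ⟨K * (8 * dist z.1 p ^ 2), by positivity, 1 / (8 * dist z.1 p), by positivity, ?_⟩
  intro w hw hwz
  rcases w with _ | w
  · exact absurd rfl hw
  have hdw : 0 < dist w.1 p := dist_pos.2 w.2
  change dist (ofNe w) (ofNe z) ≤ _ at hwz
  change |(e.symm w.1).1 - (e.symm z.1).1| ≤
    (K * (8 * dist z.1 p ^ 2) * dist (ofNe w) (ofNe z)) ^ α⁻¹
  set ρ := dist (ofNe w) (ofNe z) with hρ
  have hle := preDist_le_four_mul_dist (ofNe w) (ofNe z)
  rw [← hρ] at hle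
  have hrec := recip_sub_le (ofNe z) (ofNe w)
  rw [preDist_comm] at hrec
  have h1 : 1 / dist z.1 p - 1 / dist w.1 p ≤ 4 * ρ := hrec.trans hle
  have h2 : 1 / (2 * dist z.1 p) ≤ 1 / dist w.1 p := by
    have : 4 * (1 / (8 * dist z.1 p)) = 1 / dist z.1 p - 1 / (2 * dist z.1 p) := by
      field_simp; norm_num
    linarith
  have h3 : dist w.1 p ≤ 2 * dist z.1 p := (one_div_le_one_div (by positivity) hdw).1 h2
  have h4 : dist w.1 z.1 / (dist w.1 p * dist z.1 p) ≤ 4 * ρ := hle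
  rw [div_le_iff₀ (by positivity)] at h4
  have hρ0 : 0 ≤ ρ := dist_nonneg
  have h5 : dist w.1 z.1 ≤ 8 * dist z.1 p ^ 2 * ρ :=
    calc _ ≤ 4 * ρ * (dist w.1 p * dist z.1 p) := h4
      _ ≤ 4 * ρ * (2 * dist z.1 p * dist z.1 p) := by gcongr
      _ = _ := by ring
  have h6 := h.le_mul_dist (e.symm w.1) (e.symm z.1)
  rw [e.apply_symm_apply, e.apply_symm_apply] at h6
  have h7 : |(e.symm w.1).1 - (e.symm z.1).1| ^ α ≤ K * dist w.1 z.1 := by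
    refine le_trans ?_ h6
    rw [snowflakeProdDist]
    exact le_add_of_nonneg_right (abs_nonneg _)
  calc |(e.symm w.1).1 - (e.symm z.1).1|
      = (|(e.symm w.1).1 - (e.symm z.1).1| ^ α) ^ α⁻¹ :=
        (Real.rpow_rpow_inv (abs_nonneg _) hα.ne').symm
    _ ≤ _ := by
      refine Real.rpow_le_rpow (by positivity) (h7.trans ?_) (by positivity)
      rw [mul_assoc]
      gcongr

/-- A Lipschitz curve that avoids `∞` stays on one line. -/
theorem lineCoord_eq_of_lipschitz (h : IsComparableVia K (snowflakeProdDist α) e) (hα : 0 < α)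
    (hα1 : α < 1) {γ : ℝ → MetricInversion p} {B : ℝ} (hγ : ∀ u v, dist (γ u) (γ v) ≤ B * |u - v|)
    (hne : ∀ u, γ u ≠ none) (u v : ℝ) : lineCoord e (γ u) = lineCoord e (γ v) := by
  have hB : 0 ≤ B := by
    have := dist_nonneg.trans (hγ 1 0)
    simpa using this
  -- The exponent `1/α` exceeds `1`, so difference quotients are `O(|v - u|^(1/α - 1))` and vanish
  -- in the limit.
  have hder : ∀ u, HasDerivAt (fun u => lineCoord e (γ u)) 0 u := by
    intro u
    obtain ⟨A, hA, δ, hδ, hloc⟩ := lineCoord_local h hα (hne u)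
    have hQ : 0 < α⁻¹ - 1 := sub_pos.2 ((one_lt_inv₀ hα).2 hα1)
    have hlim : Tendsto (fun v => (A * B) ^ α⁻¹ * |v - u| ^ (α⁻¹ - 1)) (𝓝[≠] u) (𝓝 0) := by
      have : Continuous fun v : ℝ => (A * B) ^ α⁻¹ * |v - u| ^ (α⁻¹ - 1) :=
        continuous_const.mul ((by fun_prop : Continuous fun v : ℝ => |v - u|).rpow_const
          fun _ => Or.inr hQ.le)
      have h' := this.tendsto u
      simp only [sub_self, abs_zero, Real.zero_rpow hQ.ne', mul_zero] at h'
      exact h'.mono_left nhdsWithin_le_nhds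
    rw [hasDerivAt_iff_tendsto_slope]
    refine squeeze_zero_norm' ?_ hlim
    have hnear : ∀ᶠ v in 𝓝 u, B * |v - u| < δ := by
      have : Continuous fun v : ℝ => B * |v - u| := by fun_prop
      exact this.tendsto u (Iio_mem_nhds (by simpa using hδ))
    filter_upwards [self_mem_nhdsWithin, nhdsWithin_le_nhds hnear] with v hv hvδ
    have hpos : 0 < |v - u| := abs_pos.2 (sub_ne_zero.2 hv)
    rw [slope_def_field, norm_div, Real.norm_eq_abs, Real.norm_eq_abs, div_le_iff₀ hpos]
    calc _ ≤ (A * dist (γ v) (γ u)) ^ α⁻¹ := hloc _ (hne v) ((hγ v u).trans hvδ.le)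
      _ ≤ (A * (B * |v - u|)) ^ α⁻¹ := by gcongr; exact hγ v u
      _ = (A * B) ^ α⁻¹ * (|v - u| ^ (α⁻¹ - 1) * |v - u| ^ (1 : ℝ)) := by
        rw [← Real.rpow_add hpos, ← mul_assoc, Real.mul_rpow (by positivity) hpos.le]
        congr 2
        ring
      _ = _ := by rw [Real.rpow_one, mul_assoc]
  exact is_const_of_deriv_eq_zero (fun u => (hder u).differentiableAt) (fun u => (hder u).deriv) u v

theorem ne_of_snd_ne {s t : ℝ} (ht : t ≠ (e.symm p).2) : e (s, t) ≠ p := by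
  rintro rfl
  simp at ht

open Classical in
/-- The line through `e (s, ·)`, closed up by `∞`, parametrized by the reciprocal of the
second coordinate relative to `p`. -/
noncomputable def closedLine (p : X) (e : ℝ × ℝ ≃ₜ X) (s u : ℝ) : MetricInversion p :=
  if hu : u = 0 then none
  else ofNe ⟨e (s, (e.symm p).2 + u⁻¹), ne_of_snd_ne (by simpa using hu)⟩

theorem closedLine_zero (e : ℝ × ℝ ≃ₜ X) (s : ℝ) : closedLine p e s 0 = none := dif_pos rfl

theorem closedLine_of_ne (e : ℝ × ℝ ≃ₜ X) (s : ℝ) {u : ℝ} (hu : u ≠ 0) :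
    closedLine p e s u =
      ofNe ⟨e (s, (e.symm p).2 + u⁻¹), ne_of_snd_ne (by simpa using hu)⟩ := dif_neg hu

/-- On one line the snowflake term is zero. Points with parameters `u`, `v` are at distance at most
`K |1/u - 1/v|` and at least `1 / (K |u|)`, `1 / (K |v|)` from `p`; in the quotient `i_p` the
factors `|u| |v|` cancel. -/
theorem closedLine_lipschitz (h : IsComparableVia K (snowflakeProdDist α) e) (hα : 0 < α)
    (s u v : ℝ) :
    dist (closedLine p e s u) (closedLine p e s v) ≤ K ^ 3 * |u - v| := by
  have hK : 0 < K := zero_lt_one.trans_le h.1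
  have hp : ∀ u : ℝ, u ≠ 0 → (K * |u|)⁻¹ ≤ dist (e (s, (e.symm p).2 + u⁻¹)) p := by
    intro u hu
    have h1 := h.le_mul_dist (s, (e.symm p).2 + u⁻¹) (e.symm p)
    rw [e.apply_symm_apply] at h1
    have h2 : |u⁻¹| ≤ K * dist (e (s, (e.symm p).2 + u⁻¹)) p := by
      refine le_trans ?_ h1
      rw [snowflakeProdDist]
      simp only [add_sub_cancel_left]
      exact le_add_of_nonneg_left (by positivity)
    rw [mul_inv, inv_mul_le_iff₀ hK, ← abs_inv]
    exact h2
  have hK3 : K ≤ K ^ 3 := le_self_pow₀ h.1 (by norm_num)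
  have hinf : ∀ u : ℝ, u ≠ 0 → 1 / dist (e (s, (e.symm p).2 + u⁻¹)) p ≤ K ^ 3 * |u| := by
    intro u hu
    have hu' : 0 < |u| := abs_pos.2 hu
    rw [one_div]
    calc _ ≤ ((K * |u|)⁻¹)⁻¹ := inv_anti₀ (by positivity) (hp u hu)
      _ = K * |u| := inv_inv _
      _ ≤ _ := by gcongr
  refine (dist_le_preDist _ _).trans ?_
  rcases eq_or_ne u 0 with rfl | hu <;> rcases eq_or_ne v 0 with rfl | hv
  · simp [closedLine_zero, preDist]
  · rw [closedLine_zero, closedLine_of_ne e s hv, zero_sub, abs_neg]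
    exact hinf v hv
  · rw [closedLine_zero, closedLine_of_ne e s hu, sub_zero]
    exact hinf u hu
  · rw [closedLine_of_ne e s hu, closedLine_of_ne e s hv]
    have hu' : 0 < |u| := abs_pos.2 hu
    have hv' : 0 < |v| := abs_pos.2 hv
    have h1 := (h.2 (s, (e.symm p).2 + u⁻¹) (s, (e.symm p).2 + v⁻¹)).2
    have h2 : snowflakeProdDist α (s, (e.symm p).2 + u⁻¹) (s, (e.symm p).2 + v⁻¹) =
        |u - v| / (|u| * |v|) := by
      simp only [snowflakeProdDist, sub_self, abs_zero, Real.zero_rpow hα.ne', zero_add,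
        add_sub_add_left_eq_sub]
      rw [inv_sub_inv hu hv, abs_div, abs_mul, abs_sub_comm]
    rw [h2] at h1
    change dist (e (s, (e.symm p).2 + u⁻¹)) (e (s, (e.symm p).2 + v⁻¹)) /
      (dist (e (s, (e.symm p).2 + u⁻¹)) p * dist (e (s, (e.symm p).2 + v⁻¹)) p) ≤ _
    calc _ ≤ K * (|u - v| / (|u| * |v|)) / ((K * |u|)⁻¹ * (K * |v|)⁻¹) := by
          gcongr
          · exact hp u hu
          · exact hp v hv
      _ = _ := by field_simp

/-- The points off a line and off a level of the second coordinate are dense. -/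
theorem exists_near (e : ℝ × ℝ ≃ₜ X) (s₀ : ℝ) {y : {x : X // x ≠ p}} {δ : ℝ} (hδ : 0 < δ) :
    ∃ s t : ℝ, s ≠ s₀ ∧ ∃ ht : t ≠ (e.symm p).2,
      dist (ofNe ⟨e (s, t), ne_of_snd_ne ht⟩) (ofNe y) < δ := by
  set s := (e.symm y.1).1
  set t := (e.symm y.1).2
  have hst : e (s, t) = y.1 := e.apply_symm_apply y.1
  have hy : 0 < dist y.1 p := dist_pos.2 y.2
  -- A diagonal shift moves both coordinates, so each forbidden value excludes at most one `ε`.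
  let x : ℝ → X := fun ε => e (s + ε, t + ε)
  have hx : Continuous x := by fun_prop
  have hx0 : x 0 = y.1 := by simp [x, hst]
  have hlim : Tendsto (fun ε => dist (x ε) y.1 / (dist (x ε) p * dist y.1 p)) (𝓝 0) (𝓝 0) := by
    have : ContinuousAt (fun ε => dist (x ε) y.1 / (dist (x ε) p * dist y.1 p)) 0 := by
      refine ContinuousAt.div (by fun_prop) (by fun_prop) ?_
      rw [hx0]
      positivity
    have h' := this.tendsto
    simp only [hx0, dist_self, zero_div] at h'
    exact h'
  have hav : ∀ a b : ℝ, ∀ᶠ ε in 𝓝[≠] (0 : ℝ), a + ε ≠ b := by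
    intro a b
    rcases eq_or_ne a b with rfl | hab
    · filter_upwards [self_mem_nhdsWithin] with ε hε
      simpa using hε
    · have : ContinuousAt (fun ε : ℝ => a + ε) 0 := by fun_prop
      exact nhdsWithin_le_nhds (this.eventually_ne (by simpa using hab))
  obtain ⟨ε, h1, h2, h3⟩ := ((hav s s₀).and ((hav t (e.symm p).2).and
    (nhdsWithin_le_nhds (hlim.eventually (gt_mem_nhds hδ))))).exists
  exact ⟨s + ε, t + ε, h1, h2, (dist_le_preDist _ _).trans_lt h3⟩

/-- The inversion of a snowflake cylinder is not homogeneous: only at `∞` do all the lines meet. -/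
theorem not_homogeneous (h : IsComparableVia K (snowflakeProdDist α) e) (hα : 0 < α)
    (hα1 : α < 1) : ¬ IsUniformlyBiLipschitzHomogeneous (MetricInversion p) := by
  rintro ⟨L, F, hF, htr⟩
  -- A finite point on the line `s = 0`: every closed line with `s ≠ 0` misses it.
  let q : MetricInversion p :=
    ofNe ⟨e (0, (e.symm p).2 + 1), ne_of_snd_ne (by simp)⟩
  obtain ⟨f, hfF, hfq⟩ := htr none q
  obtain ⟨hL1, hL⟩ := hF f hfF
  have hL0 : 0 < L := zero_lt_one.trans_le hL1
  have hg : ∀ x y, dist (f.symm x) (f.symm y) ≤ L * dist x y := by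
    intro x y
    have := (hL (f.symm x) (f.symm y)).1
    rwa [f.apply_symm_apply, f.apply_symm_apply, inv_mul_le_iff₀ hL0] at this
  have hgne : ∀ x, x ≠ q → f.symm x ≠ none := by
    intro x hx hc
    apply hx
    rw [← hfq, ← hc, f.apply_symm_apply]
  have hqc : lineCoord e q = 0 := by simp [q, lineCoord, ofNe]
  -- The preimages of these closed lines avoid `∞`, so each stays on one line; it is the same line
  -- for all `s`, since the parameter `u = 0` always gives `f.symm none`.
  have hline : ∀ s, s ≠ 0 → ∀ u,
      lineCoord e (f.symm (closedLine p e s u)) = lineCoord e (f.symm none) := by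
    intro s hs u
    have hav : ∀ u, closedLine p e s u ≠ q := by
      intro u hc
      rcases eq_or_ne u 0 with rfl | hu
      · rw [closedLine_zero] at hc
        exact absurd hc (Option.some_ne_none _).symm
      · have := congrArg (lineCoord e) hc
        rw [hqc, closedLine_of_ne e s hu] at this
        simp only [ofNe, lineCoord, e.symm_apply_apply] at this
        exact hs this
    have := lineCoord_eq_of_lipschitz h hα hα1 (γ := fun u => f.symm (closedLine p e s u))
      (B := L * K ^ 3) (fun u v => (hg _ _).trans (by
        rw [mul_assoc]
        exact mul_le_mul_of_nonneg_left (closedLine_lipschitz h hα s u v) hL0.le))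
      (fun u => hgne _ (hav u)) u 0
    simpa only [closedLine_zero] using this
  set σ := lineCoord e (f.symm none)
  have hall : ∀ y, y ≠ q → lineCoord e (f.symm y) = σ := by
    intro y hy
    rcases y with _ | y
    · rfl
    change ofNe y ≠ q at hy
    change lineCoord e (f.symm (ofNe y)) = σ
    by_contra hne
    -- Density argument: a nearby point on a line `s ≠ 0` already has coordinate `σ`, and local
    -- Hölder continuity at `f.symm y` makes the gap `η` smaller than itself.
    obtain ⟨A, hA, δ, hδ, hloc⟩ := lineCoord_local h hα (hgne _ hy)
    have hpos : 0 < |σ - lineCoord e (f.symm (ofNe y))| := abs_pos.2 (sub_ne_zero.2 (Ne.symm hne))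
    set η := |σ - lineCoord e (f.symm (ofNe y))|
    have hη : 0 < η ^ α / (2 * A * L) := by positivity
    obtain ⟨s, t, hs, ht, hd⟩ := exists_near e 0 (y := y) (lt_min (div_pos hδ hL0) hη)
    obtain ⟨hd1, hd2⟩ := lt_min_iff.1 hd
    have hw : ofNe ⟨e (s, t), ne_of_snd_ne ht⟩ =
        closedLine p e s (t - (e.symm p).2)⁻¹ := by
      have : (t - (e.symm p).2)⁻¹ ≠ 0 := inv_ne_zero (sub_ne_zero.2 ht)
      rw [closedLine_of_ne e s this]
      simp
    set w : MetricInversion p := ofNe ⟨e (s, t), ne_of_snd_ne ht⟩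
    have hwq : w ≠ q := by
      intro hc
      have := congrArg (lineCoord e) hc
      rw [hqc] at this
      simp only [w, ofNe, lineCoord, e.symm_apply_apply] at this
      exact hs this
    rw [lt_div_iff₀ hL0] at hd1
    have h1 := hloc (f.symm w) (hgne w hwq) ((hg _ _).trans (by linarith))
    rw [hw, hline s hs, ← hw] at h1
    change η ≤ _ at h1
    have h2 : (A * dist (f.symm w) (f.symm (ofNe y))) ^ α⁻¹ < (η ^ α) ^ α⁻¹ := by
      refine Real.rpow_lt_rpow (by positivity) ?_ (by positivity)
      rw [lt_div_iff₀ (by positivity)] at hd2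
      have h3 := mul_le_mul_of_nonneg_left (hg w (ofNe y)) hA.le
      have h4 : 0 < η ^ α := by positivity
      linarith
    rw [Real.rpow_rpow_inv hpos.le hα.ne'] at h2
    linarith
  -- A finite point off the line `σ`; its image under `f` is not `q`, so `hall` would put it on that
  -- line.
  let z : MetricInversion p := ofNe ⟨e (σ + 1, (e.symm p).2 + 1), ne_of_snd_ne (by simp)⟩
  have hz : lineCoord e z = σ + 1 := by simp [z, lineCoord, ofNe]
  have hzq : f z ≠ q := by
    rw [← hfq]
    intro hc
    exact Option.some_ne_none _ (f.injective hc)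
  have := hall (f z) hzq
  rw [f.symm_apply_apply, hz] at this
  linarith

end MetricInversion

/-! ### The cylinder over a bi-Hölder line -/

namespace IsSnowflakeLine

open Set

variable {α c C : ℝ} {φ : ℝ → EuclideanSpace ℝ (Fin 2)}

/-- The homeomorphism from the plane onto the cylinder over a bi-Hölder line. -/
noncomputable def cylinderHomeo (h : IsSnowflakeLine α c C φ) (hα : 0 < α) :
    ℝ × ℝ ≃ₜ curveCylinder (range φ) where
  toFun x := ⟨!₂[φ x.1 0, φ x.1 1, x.2], x.1, by ext i; fin_cases i <;> rfl⟩
  invFun v := ((h.homeo hα).symm ⟨!₂[v.1 0, v.1 1], v.2⟩, v.1 2)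
  left_inv x := by
    refine Prod.ext ?_ rfl
    rw [Homeomorph.symm_apply_eq]
    ext i
    fin_cases i <;> rfl
  right_inv v := by
    have hv : φ ((h.homeo hα).symm ⟨!₂[v.1 0, v.1 1], v.2⟩) = !₂[v.1 0, v.1 1] :=
      congrArg Subtype.val ((h.homeo hα).apply_symm_apply ⟨!₂[v.1 0, v.1 1], v.2⟩)
    ext i
    fin_cases i
    · exact congrArg (· 0) hv
    · exact congrArg (· 1) hv
    · rfl
  continuous_toFun := by
    have := h.continuous hα
    refine Continuous.subtype_mk ((PiLp.continuous_toLp 2 _).comp (continuous_pi fun i => ?_)) _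
    fin_cases i <;> simp <;> fun_prop
  continuous_invFun := by
    refine Continuous.prodMk ((h.homeo hα).symm.continuous.comp (Continuous.subtype_mk
      ((PiLp.continuous_toLp 2 _).comp (continuous_pi fun i => ?_)) _)) (by fun_prop)
    fin_cases i <;> simp <;> fun_prop

theorem dist_cylinderHomeo_sq (h : IsSnowflakeLine α c C φ) (hα : 0 < α) (x y : ℝ × ℝ) :
    dist (h.cylinderHomeo hα x) (h.cylinderHomeo hα y) ^ 2 =
      dist (φ x.1) (φ y.1) ^ 2 + |x.2 - y.2| ^ 2 := by
  change dist (!₂[φ x.1 0, φ x.1 1, x.2] : EuclideanSpace ℝ (Fin 3))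
    !₂[φ y.1 0, φ y.1 1, y.2] ^ 2 = _
  rw [EuclideanSpace.dist_sq_eq, EuclideanSpace.dist_sq_eq, Fin.sum_univ_three, Fin.sum_univ_two]
  simp [Real.dist_eq]

/-- The cylinder over a bi-Hölder line is a product of the snowflaked line and the line. -/
theorem comparable_cylinder (h : IsSnowflakeLine α c C φ) (hα : 0 < α) :
    IsComparableVia (1 + c⁻¹ + C) (snowflakeProdDist α) (h.cylinderHomeo hα) := by
  have hc := h.1
  have hC := h.2.1
  have hci : 0 < c⁻¹ := inv_pos.2 hc
  refine ⟨by linarith, fun x y => ?_⟩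
  have hsq := h.dist_cylinderHomeo_sq hα x y
  obtain ⟨h1, h2⟩ := h.2.2 x.1 y.1
  set d := dist (h.cylinderHomeo hα x) (h.cylinderHomeo hα y)
  set a := dist (φ x.1) (φ y.1)
  have hd : 0 ≤ d := dist_nonneg
  have ha : 0 ≤ a := dist_nonneg
  have hb : 0 ≤ |x.2 - y.2| := abs_nonneg _
  have hs : 0 ≤ |x.1 - y.1| ^ α := by positivity
  have had : a ≤ d := by nlinarith
  have hbd : |x.2 - y.2| ≤ d := by nlinarith
  rw [snowflakeProdDist]
  constructor
  · rw [inv_mul_le_iff₀ (by positivity)]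
    have : |x.1 - y.1| ^ α ≤ c⁻¹ * d := by
      rw [inv_mul_eq_div, le_div_iff₀ hc]
      linarith
    nlinarith
  · have : d ≤ a + |x.2 - y.2| := by nlinarith
    nlinarith

theorem comparable_line (h : IsSnowflakeLine α c C φ) (hα : 0 < α) :
    IsComparableVia (1 + c⁻¹ + C) (fun s t => |s - t| ^ α) (h.homeo hα) := by
  have hc := h.1
  have hC := h.2.1
  have hci : 0 < c⁻¹ := inv_pos.2 hc
  refine ⟨by linarith, fun s t => ?_⟩
  change _ ≤ dist (φ s) (φ t) ∧ dist (φ s) (φ t) ≤ _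
  obtain ⟨h1, h2⟩ := h.2.2 s t
  have hs : 0 ≤ |s - t| ^ α := by positivity
  have hd : 0 ≤ dist (φ s) (φ t) := dist_nonneg
  constructor
  · rw [inv_mul_le_iff₀ (by positivity)]
    have : |s - t| ^ α ≤ c⁻¹ * dist (φ s) (φ t) := by
      rw [inv_mul_eq_div, le_div_iff₀ hc]
      linarith
    nlinarith
  · nlinarith

theorem homogeneousGroup_line (h : IsSnowflakeLine α c C φ) (hα : 0 < α) :
    IsUniformlyBiLipschitzHomogeneousGroup (range φ) :=
  (h.comparable_line hα).homogeneousGroup fun s t =>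
    ⟨Homeomorph.addRight (t - s), fun u v => by simp, by simp⟩

theorem homogeneousGroup_cylinder (h : IsSnowflakeLine α c C φ) (hα : 0 < α) :
    IsUniformlyBiLipschitzHomogeneousGroup (curveCylinder (range φ)) :=
  (h.comparable_cylinder hα).homogeneousGroup fun x y =>
    ⟨Homeomorph.addRight (y - x), fun u v => by simp [snowflakeProdDist], by simp⟩

theorem isQuasiSelfSimilar_cylinder (h : IsSnowflakeLine α c C φ) (hα : 0 < α) :
    IsQuasiSelfSimilar (curveCylinder (range φ)) := by
  refine (h.comparable_cylinder hα).isQuasiSelfSimilar 0 fun s hs => ?_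
  have hs0 : 0 < s := by linarith
  have hr : 0 < s ^ α⁻¹ := by positivity
  -- Anisotropic dilation: stretching the first coordinate by `s^(1/α)` multiplies its snowflaked
  -- distance by `s`.
  refine ⟨(Homeomorph.mulLeft₀ (s ^ α⁻¹) hr.ne').prodCongr (Homeomorph.mulLeft₀ s hs0.ne'),
    Prod.ext (mul_zero _) (mul_zero _), fun u v => ?_⟩
  change |s ^ α⁻¹ * u.1 - s ^ α⁻¹ * v.1| ^ α + |s * u.2 - s * v.2| =
    s * (|u.1 - v.1| ^ α + |u.2 - v.2|)
  rw [← mul_sub, ← mul_sub, abs_mul, abs_mul, abs_of_pos hr, abs_of_pos hs0,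
    Real.mul_rpow hr.le (abs_nonneg _), Real.rpow_inv_rpow hs0.le hα.ne', mul_add]

end IsSnowflakeLine

theorem mainTheorem8 (Q : ℝ) (hQ₁ : 1 < Q) (hQ₂ : Q < 2) :
    ∃ Γ : Set (EuclideanSpace ℝ (Fin 2)),
      Nonempty (Γ ≃ₜ ℝ) ∧ ProperSpace Γ ∧ IsAhlforsRegular Q Γ ∧
      IsUniformlyBiLipschitzHomogeneousGroup Γ ∧
      Nonempty (curveCylinder Γ ≃ₜ EuclideanSpace ℝ (Fin 2)) ∧
      IsQuasiSelfSimilar (curveCylinder Γ) ∧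
      IsUniformlyBiLipschitzHomogeneousGroup (curveCylinder Γ) ∧
      ¬ IsInversionInvariantBiLipschitzHomogeneous (curveCylinder Γ) := by
  have hQ : 0 < Q := by linarith
  have hα : 0 < Q⁻¹ := by positivity
  have hα1 : Q⁻¹ < 1 := inv_lt_one_of_one_lt₀ hQ₁
  obtain ⟨c, C, φ, h⟩ := Koch.exists_isSnowflakeLine (α := Q⁻¹)
    (by rw [one_div]; exact inv_strictAnti₀ hQ hQ₂) hα1
  refine ⟨Set.range φ, ⟨(h.homeo hα).symm⟩, ?_, ?_, h.homogeneousGroup_line hα, ⟨?_⟩,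
    h.isQuasiSelfSimilar_cylinder hα, h.homogeneousGroup_cylinder hα, ?_⟩
  · exact .of_isClosed (h.isClosedEmbedding hα).isClosed_range
  · have := h.isAhlforsRegular hα
    rwa [inv_inv] at this
  · exact (h.cylinderHomeo hα).symm.trans
      ((Homeomorph.finTwoArrow (X := ℝ)).symm.trans (PiLp.homeomorph 2 _).symm)
  -- The cylinder itself is homogeneous; it is the inversion that fails, at every base point.
  · rintro ⟨p, -, hp⟩
    exact MetricInversion.not_homogeneous (h.comparable_cylinder hα) hα hα1 hp
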